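/- Let $\mathcal P=(P,\prec)$ be the generic partial order, that is, the (countable) Fraïssé limit of the class of finite partial orders. Call $D\subseteq P$ dense if for all $x\prec z$ in $P$ there is $y\in D$ with $x\prec y\prec z$, and let $P=P_0\sqcup P_1\sqcup P_2$ be a partition of $P$ into three dense subsets. For a set $X$ of pairs from $P$, let $T^X_{-1}=X$, let $T^X_{1}=\{(x,y):(y,x)\in X\}$, and let $T^X_0$ consist of all remaining pairs; read the indices modulo $3$. Let $\mathcal P(3)=(P,E)$ be the directed graph on $P$ such that, for all $k$ modulo $3$ and all $x\in P_i$, $y\in P_j$, $$(x,y)\in T^{E}_{k+(j-i)}\iff (x,y)\in T^{\prec}_{k}.$$ Let $<$ be a linear order on $P$ extending $\prec$ such that the expansion $\mathcal P(3)^*=(P,E,P_0,P_1,P_2,<)$ of $\mathcal P(3)$, with $P_0,P_1,P_2$ as unary relations, is a Fraïssé structure (countable, locally finite and homogeneous). The age of a structure is the class of all finite structures that embed in it. Theorem. $\mathrm{Age}(\mathcal P(3)^*)$ has the expansion property relative to $\mathrm{Age}(\mathcal P(3))$: for every $\mathbf A\in\mathrm{Age}(\mathcal P(3))$ there is $\mathbf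 C\in\mathrm{Age}(\mathcal P(3))$ such that for all $\mathbf A^*,\mathbf C^*\in\mathrm{Age}(\mathcal P(3)^*)$ whose reducts to the signature $\{E\}$ are $\mathbf A$ and $\mathbf C$ respectively, $\mathbf A^*$ embeds in $\mathbf C^*$. -/

import Mathlib

open FirstOrder CategoryTheory

/-! ### Fraïssé structures and the expansion property -/

/-- A Fraïssé structure: a countable, locally finite, homogeneous structure. -/
structure IsFraisseStructure {L : Language} (M : Bundled L.Structure) : Prop where
  countable : Countable M
  locallyFinite : ∀ S : L.Substructure M, S.FG → Finite S
  homogeneous : L.IsUltrahomogeneous M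

/-- Let `φ : L →ᴸ L'` be an inclusion of languages. The class `K'` of `L'`-structures has the
expansion property relative to the class `K` of `L`-structures when every `A ∈ K` has some `B ∈ K`
such that every `A' ∈ K'` with `L`-reduct `A` embeds into every `B' ∈ K'` with `L`-reduct `B`. -/
def HasExpansionProperty {L L' : Language} (φ : L →ᴸ L')
    (K' : Set (Bundled L'.Structure)) (K : Set (Bundled L.Structure)) : Prop :=
  ∀ A ∈ K, ∃ B ∈ K, ∀ (sA : L'.Structure A) (sB : L'.Structure B),
    (⟨A, sA⟩ : Bundled L'.Structure) ∈ K' → (⟨B, sB⟩ : Bundled L'.Structure) ∈ K' →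
    φ.reduct A = A.str → φ.reduct B = B.str →
    Nonempty ((⟨A, sA⟩ : Bundled L'.Structure) ↪[L'] (⟨B, sB⟩ : Bundled L'.Structure))

/-! ### The two signatures -/

/-- The relation symbols of `{E}`. -/
inductive DigraphRel : ℕ → Type
  | edge : DigraphRel 2

/-- The signature `{E}` of directed graphs. -/
def digraphLang : Language := ⟨fun _ => Empty, DigraphRel⟩

instance : digraphLang.IsRelational := fun _ => inferInstanceAs (IsEmpty Empty)

/-- The relation symbols of `{E, R₀, R₁, R₂, <}`. -/
inductive ExpRel : ℕ → Type
  | edge : ExpRel 2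
  | part (i : ZMod 3) : ExpRel 1
  | lt : ExpRel 2

/-- The signature `{E, R₀, R₁, R₂, <}`. -/
def expLang : Language := ⟨fun _ => Empty, ExpRel⟩

instance : expLang.IsRelational := fun _ => inferInstanceAs (IsEmpty Empty)

/-- The inclusion of `{E}` in `{E, R₀, R₁, R₂, <}`. -/
def digraphToExp : digraphLang →ᴸ expLang where
  onFunction := fun _ f => nomatch f
  onRelation := fun _ r => match r with
    | DigraphRel.edge => ExpRel.edge

/-! ### The generic partial order and its dense partitions -/

/-- `P` is the generic partial order: the Fraïssé limit of the class of all finite partial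
orders. -/
def IsGenericPartialOrder (P : Type*) [PartialOrder P] [Countable P] : Prop :=
  letI : Language.order.Structure P := Language.orderStructure P
  Language.IsFraisseLimit
    {M : Bundled Language.order.Structure | Finite M ∧ M ⊨ Language.order.partialOrderTheory} P

/-- `D` is dense: it meets every interval between two points `x < z` of `P`. -/
def IsDenseIn {P : Type*} [PartialOrder P] (D : Set P) : Prop :=
  ∀ x z : P, x < z → ∃ y ∈ D, x < y ∧ y < z

/-- `Q 0, Q 1, Q 2` is a partition of `P` into three dense subsets. -/
structure IsDensePartition {P : Type*} [PartialOrder P] (Q : ZMod 3 → Set P) : Prop where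
  existsUnique : ∀ x, ∃! i, x ∈ Q i
  dense : ∀ i, IsDenseIn (Q i)

/-! ### Twisting -/

/-- The relations `T₋₁, T₀, T₁` attached to a set `X` of pairs, indexed modulo 3: `T₋₁` is `X`,
`T₁` is its converse, and `T₀` holds of the remaining pairs. -/
def TwistRel {P : Type*} (X : P → P → Prop) (k : ZMod 3) (x y : P) : Prop :=
  (k = -1 ∧ X x y) ∨ (k = 1 ∧ X y x) ∨ (k = 0 ∧ ¬ X x y ∧ ¬ X y x)

/-- The edges of `𝒫(3)`: for `x ∈ Q i` and `y ∈ Q j`, the pair `(x, y)` is an edge when it lies in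
`T_k` of the strict order for the `k` with `k + (j - i) = -1` modulo 3. -/
def twistedEdge {P : Type*} [PartialOrder P] (Q : ZMod 3 → Set P) (x y : P) : Prop :=
  ∃ i j k : ZMod 3, x ∈ Q i ∧ y ∈ Q j ∧ k + (j - i) = -1 ∧ TwistRel (fun a b : P => a < b) k x y

theorem twistedEdge_iff {P : Type*} [PartialOrder P] {Q : ZMod 3 → Set P}
    (hQ : ∀ x, ∃! i, x ∈ Q i) {x y : P} {i j : ZMod 3} (hx : x ∈ Q i) (hy : y ∈ Q j) :
    twistedEdge Q x y ↔ TwistRel (fun a b : P => a < b) (-1 - (j - i)) x y := by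
  constructor
  · rintro ⟨i', j', k, hi, hj, hk, h⟩
    obtain rfl := (hQ x).unique hx hi
    obtain rfl := (hQ y).unique hy hj
    rwa [← hk, add_sub_cancel_right]
  · intro h
    exact ⟨i, j, _, hx, hy, sub_add_cancel _ _, h⟩

/-- The defining property of the edges of `𝒫(3)`: for `x ∈ Q i` and `y ∈ Q j`, the pair `(x, y)` is
in `T_(k + (j - i))` of the twisted edges if and only if it is in `T_k` of the strict order. -/
theorem twistRel_twistedEdge_iff {P : Type*} [PartialOrder P] {Q : ZMod 3 → Set P}
    (hQ : ∀ x, ∃! i, x ∈ Q i) {x y : P} {i j : ZMod 3} (hx : x ∈ Q i) (hy : y ∈ Q j)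
    (k : ZMod 3) :
    TwistRel (twistedEdge Q) (k + (j - i)) x y ↔ TwistRel (fun a b : P => a < b) k x y := by
  have hxy := lt_asymm (a := x) (b := y)
  have h1 := twistedEdge_iff hQ hx hy
  have h2 := twistedEdge_iff hQ hy hx
  have h3 : i - j = -(j - i) := by ring
  rw [h3] at h2
  unfold TwistRel at *
  rw [h1, h2]
  clear h1 h2 h3
  generalize j - i = d
  by_cases ha : x < y <;> by_cases hb : y < x <;> simp only [ha, hb] at hxy ⊢
  · exact absurd trivial (hxy trivial)
  all_goals
    simp only [and_true, and_false, false_or, or_false, not_true, not_false_eq_true]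
    clear * -
    revert d k
    decide

/-! ### The structures `𝒫(3)` and `𝒫(3)*` -/

/-- The directed graph `𝒫(3)` built from the partition `Q` of `P`. -/
def P3 {P : Type*} [PartialOrder P] (Q : ZMod 3 → Set P) : Bundled digraphLang.Structure where
  α := P
  str :=
    { funMap := fun f => nomatch f
      RelMap := fun r => match r with
        | DigraphRel.edge => fun v => twistedEdge Q (v 0) (v 1) }

/-- The expansion `𝒫(3)*` of `𝒫(3)` by the parts `Q 0, Q 1, Q 2` and the relation `lt`. -/
def P3star {P : Type*} [PartialOrder P] (Q : ZMod 3 → Set P) (lt : P → P → Prop) :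
    Bundled expLang.Structure where
  α := P
  str :=
    { funMap := fun f => nomatch f
      RelMap := fun r => match r with
        | ExpRel.edge => fun v => twistedEdge Q (v 0) (v 1)
        | ExpRel.part i => fun v => v 0 ∈ Q i
        | ExpRel.lt => fun v => lt (v 0) (v 1) }

/-- `lt` is a (strict) linear order on `P` extending the strict order of `P`. -/
structure IsLinearExtension {P : Type*} [PartialOrder P] (lt : P → P → Prop) : Prop where
  strictTotal : IsStrictTotalOrder P lt
  extends_lt : ∀ x y : P, x < y → lt x y

/-! The witness `C` depends only on `n = |A|`. It is the twisted digraph of a large grid of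
dimension `n + 2`, ordered by strict increase in all coordinates, with a point of each colour over
every grid point. An expansion of `C` in the age is a second copy of this digraph in `P`, whose
colours, partial order and linear order may all be new.

Product Ramsey (`exists_subgrid_color_eq`) yields a subgrid on which the new colour depends only on
the old one, and `lt`, between points differing in every coordinate, only on the sign pattern and
the old colours. If the colour shift rose by one between two colours, transitivity would fail in the
new order (`shift_ne_of_twistedEdge_iff`). Modulo 3 the shift is therefore constant, so the partial
order is unchanged and the colours are merely rotated. The sign patterns for which `lt` holds form
an ultrafilter on the finite set of coordinates, so one coordinate decides `lt`
(`exists_coordinate_forall_mem_iff`).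

That coordinate is not known in advance. But any `A*` is coded in the grid by linear extensions
whose intersection is its partial order, and its own linear order can be put at whichever coordinate
is needed (`IsLinearExtension.exists_realizer`). -/

/-! ### Ramsey's theorem for pairs, and for pairs in products -/

/-- A colouring of the pairs of a large finite linear order is, on some subset of prescribed size,
determined by the smaller point of each pair. -/
theorem exists_card_eq_forall_lt_color_eq {K : Type*} [Finite K] (m : ℕ) :
    ∃ N : ℕ, ∀ {α : Type} [LinearOrder α] (χ : α → α → K) (S : Finset α), N ≤ S.card →
      ∃ T ⊆ S, T.card = m ∧ ∃ g : α → K, ∀ a ∈ T, ∀ b ∈ T, a < b → χ a b = g a := by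
  classical
  have := Fintype.ofFinite K
  induction m with
  | zero => exact ⟨0, fun χ S _ => ⟨∅, by simp, by simp, fun a => χ a a, by simp⟩⟩
  | succ m ih =>
    obtain ⟨N, hN⟩ := ih
    -- One point is the minimum; by pigeonhole, `N` of the others have the same colour with it.
    refine ⟨Fintype.card K * N + 1, fun {α} _ χ S hS => ?_⟩
    have hne : S.Nonempty := Finset.card_pos.1 (by omega)
    set a := S.min' hne with ha
    have haS : a ∈ S := S.min'_mem hne
    have hcard : (Finset.univ : Finset K).card * N ≤ (S.erase a).card := by
      rw [Finset.card_erase_of_mem haS, Finset.card_univ]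
      omega
    obtain ⟨k, -, hk⟩ := Finset.exists_le_card_fiber_of_mul_le_card_of_maps_to
      (f := χ a) (fun _ _ => Finset.mem_univ _) ⟨χ a a, Finset.mem_univ _⟩ hcard
    obtain ⟨T, hTS, hT, g, hg⟩ := hN χ _ hk
    have hTa : ∀ b ∈ T, b ∈ S ∧ a < b ∧ χ a b = k := by
      intro b hb
      have h := hTS hb
      simp only [Finset.mem_filter, Finset.mem_erase] at h
      exact ⟨h.1.2, lt_of_le_of_ne (S.min'_le b h.1.2) (Ne.symm h.1.1), h.2⟩
    have haT : a ∉ T := fun h => lt_irrefl _ (hTa a h).2.1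
    refine ⟨insert a T, ?_, by rw [Finset.card_insert_of_notMem haT, hT],
      Function.update g a k, ?_⟩
    · intro b hb
      rcases Finset.mem_insert.1 hb with rfl | hb
      · exact haS
      · exact (hTa b hb).1
    · intro b hb c hc hbc
      rcases Finset.mem_insert.1 hb with rfl | hb
      · rcases Finset.mem_insert.1 hc with rfl | hc
        · exact absurd hbc (lt_irrefl _)
        · rw [Function.update_self]
          exact (hTa c hc).2.2
      · rcases Finset.mem_insert.1 hc with rfl | hc
        · exact absurd hbc (hTa b hb).2.1.asymm
        · rw [Function.update_of_ne (hTa b hb).2.1.ne']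
          exact hg b hb c hc hbc

/-- The finite Ramsey theorem for pairs. -/
theorem exists_strictMono_color_eq {K : Type*} [Finite K] [Nonempty K] (l : ℕ) :
    ∃ N : ℕ, ∀ M ≥ N, ∀ χ : Fin M → Fin M → K, ∃ q : Fin l → Fin M, StrictMono q ∧
      ∃ k : K, ∀ s t, s < t → χ (q s) (q t) = k := by
  classical
  have := Fintype.ofFinite K
  obtain ⟨N, hN⟩ := exists_card_eq_forall_lt_color_eq (K := K) (Fintype.card K * l)
  refine ⟨N, fun M hM χ => ?_⟩
  obtain ⟨T, -, hT, g, hg⟩ := hN χ Finset.univ (by simpa using hM)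
  obtain ⟨k, -, hk⟩ := Finset.exists_le_card_fiber_of_mul_le_card_of_maps_to (s := T)
    (t := Finset.univ) (f := g) (n := l) (fun _ _ => Finset.mem_univ _)
    Finset.univ_nonempty (by rw [hT, Finset.card_univ])
  obtain ⟨U, hUT, hU⟩ := Finset.exists_subset_card_eq hk
  refine ⟨U.orderEmbOfFin hU, (U.orderEmbOfFin hU).strictMono, k, fun s t hst => ?_⟩
  have hs := Finset.mem_filter.1 (hUT (U.orderEmbOfFin_mem hU s))
  have ht := Finset.mem_filter.1 (hUT (U.orderEmbOfFin_mem hU t))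
  rw [hg _ hs.1 _ ht.1 ((U.orderEmbOfFin hU).strictMono hst), hs.2]

/-- The product Ramsey theorem for pairs: for every colouring of the pairs of points of a large
`d`-dimensional grid there is a subgrid of side `l` in which the colour of two points that differ
in all coordinates depends only on the set of coordinates where the first is the smaller. -/
theorem exists_subgrid_color_eq (l d : ℕ) {K : Type*} [Finite K] [Nonempty K] :
    ∃ N : ℕ, ∀ M ≥ N, ∀ χ : (Fin d → Fin M) → (Fin d → Fin M) → K,
      ∃ q : Fin d → Fin l → Fin M, (∀ i, StrictMono (q i)) ∧ ∃ κ : Set (Fin d) → K,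
        ∀ s t : Fin d → Fin l, (∀ i, s i ≠ t i) →
          χ (fun i => q i (s i)) (fun i => q i (t i)) = κ {i | s i < t i} := by
  classical
  induction d generalizing K with
  | zero =>
    refine ⟨0, fun M _ χ => ⟨fun i => i.elim0, fun i => i.elim0,
      fun _ => χ (fun i => i.elim0) (fun i => i.elim0), fun s t _ => ?_⟩⟩
    congr 1 <;> exact Subsingleton.elim _ _
  | succ d ih =>
    -- The new coordinate is cut down to `N₁` values beforehand, so that the table of all its
    -- colours is itself a colour from a finite set not depending on `M`. Both orders of the pair
    -- are recorded, since the new coordinate may decrease.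
    obtain ⟨N₁, h₁⟩ := exists_strictMono_color_eq (K := Set (Fin d) → K × K) l
    obtain ⟨N₂, h₂⟩ := ih (K := Fin N₁ → Fin N₁ → K)
    refine ⟨max N₁ N₂, fun M hM χ => ?_⟩
    have hM₁ : N₁ ≤ M := (le_max_left _ _).trans hM
    obtain ⟨q, hq, κ, hκ⟩ := h₂ M ((le_max_right _ _).trans hM) fun x y a b =>
      χ (Fin.cons (Fin.castLE hM₁ a) x) (Fin.cons (Fin.castLE hM₁ b) y)
    obtain ⟨p, hp, k, hk⟩ := h₁ N₁ le_rfl fun a b S => (κ S a b, κ S b a)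
    refine ⟨Fin.cons (fun t => Fin.castLE hM₁ (p t)) q, ?_, fun S =>
      if 0 ∈ S then (k {i | i.succ ∈ S}).1 else (k {i | i.succ ∈ S}).2, fun s t hst => ?_⟩
    · refine Fin.cases ?_ hq
      intro a b hab
      simpa using hp hab
    · have hcons : ∀ u : Fin (d + 1) → Fin l,
          (fun i => (Fin.cons (fun t => Fin.castLE hM₁ (p t)) q :
            Fin (d + 1) → Fin l → Fin M) i (u i)) =
          Fin.cons (Fin.castLE hM₁ (p (u 0))) (fun i => q i (u i.succ)) := by
        intro u
        funext i
        refine Fin.cases ?_ (fun i => ?_) i <;> simp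
      have h := congrFun (congrFun (hκ (fun i => s i.succ) (fun i => t i.succ)
        fun i => hst i.succ) (p (s 0))) (p (t 0))
      rw [hcons, hcons]
      refine h.trans ?_
      rcases lt_or_gt_of_ne (hst 0) with h0 | h0
      · have := congrFun (hk _ _ h0) {i | s i.succ < t i.succ}
        simp [h0, ← this]
      · have := congrFun (hk _ _ h0) {i | s i.succ < t i.succ}
        simp [h0.asymm, ← this]

/-! ### Coloured finite orders in the generic partial order -/

/-- Every finite partial order embeds in the generic partial order. -/
theorem IsGenericPartialOrder.nonempty_orderEmbedding {P : Type*} [PartialOrder P] [Countable P]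
    (hP : IsGenericPartialOrder P) (G : Type) [PartialOrder G] [Finite G] : Nonempty (G ↪o P) := by
  let : Language.order.Structure P := Language.orderStructure P
  let : Language.order.Structure (ULift G) := Language.orderStructure (ULift G)
  have : Language.order.OrderedStructure P := ⟨fun _ => Iff.rfl⟩
  have : Language.order.OrderedStructure (ULift G) := ⟨fun _ => Iff.rfl⟩
  have hage := Language.IsFraisseLimit.age hP
  have hmem : (⟨ULift G, inferInstance⟩ : Bundled Language.order.Structure) ∈
      Language.order.age P := by
    rw [hage]
    exact ⟨inferInstanceAs (Finite (ULift G)),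
      (inferInstance : ULift G ⊨ Language.order.partialOrderTheory)⟩
  obtain ⟨-, ⟨f⟩⟩ := hmem
  refine ⟨⟨⟨fun g => f ⟨g⟩, fun a b h => congrArg ULift.down (f.injective h)⟩, ?_⟩⟩
  intro a b
  have := f.map_rel Language.orderRel.le ![⟨a⟩, ⟨b⟩]
  exact this

/-- Doubling of the points of a strict order to chains with two elements. -/
@[reducible]
def doubledPartialOrder {G : Type} (r : G → G → Prop) (hirr : ∀ x, ¬ r x x)
    (htr : ∀ x y z, r x y → r y z → r x z) : PartialOrder (G × Bool) where
  le p q := (p.1 = q.1 ∧ p.2 ≤ q.2) ∨ r p.1 q.1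
  le_refl p := Or.inl ⟨rfl, le_rfl⟩
  le_trans := by
    rintro ⟨x, a⟩ ⟨y, b⟩ ⟨z, c⟩ (⟨rfl, h₁⟩ | h₁) (⟨rfl, h₂⟩ | h₂)
    · exact Or.inl ⟨rfl, h₁.trans h₂⟩
    · exact Or.inr h₂
    · exact Or.inr h₁
    · exact Or.inr (htr _ _ _ h₁ h₂)
  le_antisymm := by
    rintro ⟨x, a⟩ ⟨y, b⟩ (⟨h, h₁⟩ | h₁) (⟨h', h₂⟩ | h₂)
    · exact Prod.ext h (le_antisymm h₁ h₂)
    · exact absurd (h ▸ h₂) (hirr _)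
    · exact absurd (h' ▸ h₁) (hirr _)
    · exact absurd (htr _ _ _ h₁ h₂) (hirr _)

/-- Every finite strict order with a colouring by three colours is realised in a dense partition
of the generic partial order. -/
theorem IsGenericPartialOrder.exists_colored_embedding {P : Type*} [PartialOrder P] [Countable P]
    (hP : IsGenericPartialOrder P) {Q : ZMod 3 → Set P} (hQ : IsDensePartition Q)
    {G : Type} [Finite G] (r : G → G → Prop) (hirr : ∀ x, ¬ r x x)
    (htr : ∀ x y z, r x y → r y z → r x z) (c : G → ZMod 3) :
    ∃ e : G → P, Function.Injective e ∧ (∀ x, e x ∈ Q (c x)) ∧ ∀ x y, e x < e y ↔ r x y := by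
  -- Density gives a point of any colour between the two ends of each doubled point, and related
  -- points have disjoint, comparable intervals.
  let := doubledPartialOrder r hirr htr
  obtain ⟨f⟩ := hP.nonempty_orderEmbedding (G × Bool)
  have hle : ∀ p q : G × Bool, p ≤ q ↔ (p.1 = q.1 ∧ p.2 ≤ q.2) ∨ r p.1 q.1 := fun _ _ => Iff.rfl
  have hbt : ∀ x, f (x, false) < f (x, true) := by
    intro x
    rw [f.lt_iff_lt, lt_iff_le_not_ge, hle, hle]
    simp [hirr]
  choose e he using fun x => hQ.dense (c x) _ _ (hbt x)
  have hlt : ∀ x y, e x < e y → r x y := by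
    intro x y h
    have h1 := f.le_iff_le.1 (((he x).2.1.trans h).trans (he y).2.2).le
    rcases (hle _ _).1 h1 with ⟨h2, -⟩ | h2
    · obtain rfl : x = y := h2
      exact absurd h (lt_irrefl _)
    · exact h2
  refine ⟨e, fun x y h => ?_, fun x => (he x).1, fun x y => ⟨hlt x y, fun h => ?_⟩⟩
  · have h1 : f (x, false) ≤ f (y, true) := ((he x).2.1.trans (h ▸ (he y).2.2)).le
    rcases (hle _ _).1 (f.le_iff_le.1 h1) with ⟨h2, -⟩ | h2
    · exact h2
    · have h3 : f (x, true) ≤ f (y, false) := f.le_iff_le.2 ((hle _ _).2 (Or.inr h2))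
      exact absurd h (((he x).2.2.trans_le h3).trans (he y).2.1).ne
  · have h3 : f (x, true) ≤ f (y, false) := f.le_iff_le.2 ((hle _ _).2 (Or.inr h))
    exact ((he x).2.2.trans_le h3).trans (he y).2.1

/-! ### Comparison of two twisted copies of the same directed graph -/

theorem twistRel_neg_one {P : Type*} {X : P → P → Prop} {x y : P} :
    TwistRel X (-1) x y ↔ X x y := by
  have h1 : ((-1 : ZMod 3) = 1) = False := by decide
  have h2 : ((-1 : ZMod 3) = 0) = False := by decide
  simp [TwistRel, h1, h2]

theorem twistRel_one {P : Type*} {X : P → P → Prop} {x y : P} :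
    TwistRel X 1 x y ↔ X y x := by
  have h1 : ((1 : ZMod 3) = -1) = False := by decide
  have h2 : ((1 : ZMod 3) = 0) = False := by decide
  simp [TwistRel, h1, h2]

theorem twistRel_zero {P : Type*} {X : P → P → Prop} {x y : P} :
    TwistRel X 0 x y ↔ ¬ X x y ∧ ¬ X y x := by
  have h1 : ((0 : ZMod 3) = -1) = False := by decide
  have h2 : ((0 : ZMod 3) = 1) = False := by decide
  simp [TwistRel, h1, h2]

section TwoCopies

variable {P G : Type*} [PartialOrder P] {Q : ZMod 3 → Set P} {e f : G → P} {a b : G → ZMod 3}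

/-- If two maps into `P` induce the same twisted edges, the orders that they induce differ by the
twist by the difference of the colourings. -/
theorem twistRel_lt_iff_of_twistedEdge_iff (hQ : ∀ x, ∃! i, x ∈ Q i) (he : ∀ p, e p ∈ Q (a p))
    (hf : ∀ p, f p ∈ Q (b p))
    (hE : ∀ p q, twistedEdge Q (e p) (e q) ↔ twistedEdge Q (f p) (f q)) (k : ZMod 3) (p q : G) :
    TwistRel (fun x y : P => x < y) k (e p) (e q) ↔
      TwistRel (fun x y : P => x < y) (k + (a q - a p) - (b q - b p)) (f p) (f q) := by
  rw [← twistRel_twistedEdge_iff hQ (he p) (he q), ← twistRel_twistedEdge_iff hQ (hf p) (hf q),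
    sub_add_cancel]
  unfold TwistRel
  rw [hE p q, hE q p]

/-- Equal colour shifts make the two twists cancel. -/
theorem lt_iff_lt_of_twistedEdge_iff (hQ : ∀ x, ∃! i, x ∈ Q i) (he : ∀ p, e p ∈ Q (a p))
    (hf : ∀ p, f p ∈ Q (b p))
    (hE : ∀ p q, twistedEdge Q (e p) (e q) ↔ twistedEdge Q (f p) (f q)) {p q : G}
    (hpq : b p - a p = b q - a q) : e p < e q ↔ f p < f q := by
  have h := twistRel_lt_iff_of_twistedEdge_iff hQ he hf hE (-1) p q
  rwa [show -1 + (a q - a p) - (b q - b p) = (-1 : ZMod 3) by linear_combination hpq,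
    twistRel_neg_one, twistRel_neg_one] at h

/-- The colour shift between two copies cannot increase by one between colour classes in which a
point and an antichain of two points above and beside it can be found. -/
theorem shift_ne_of_twistedEdge_iff (hQ : ∀ x, ∃! i, x ∈ Q i) (he : ∀ p, e p ∈ Q (a p))
    (hf : ∀ p, f p ∈ Q (b p))
    (hE : ∀ p q, twistedEdge Q (e p) (e q) ↔ twistedEdge Q (f p) (f q)) {p q r : G}
    (hqr : b q - a q = b r - a r) (hlt : e p < e q) (hpr : ¬ e p < e r) (hrp : ¬ e r < e p)
    (h : ¬ e q < e r) : b q - a q ≠ 1 + (b p - a p) := by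
  intro hs
  -- The twist yields `f q < f p` and `f p < f r`; as `q` and `r` have equal shifts, `f q < f r`
  -- pulls back to `e q < e r`.
  have h1 := twistRel_lt_iff_of_twistedEdge_iff hQ he hf hE (-1) p q
  rw [show -1 + (a q - a p) - (b q - b p) = (1 : ZMod 3) by
      linear_combination (-1 : ZMod 3) * hs + (by decide : (-3 : ZMod 3) = 0),
    twistRel_neg_one, twistRel_one] at h1
  have h2 := twistRel_lt_iff_of_twistedEdge_iff hQ he hf hE 0 p r
  rw [show 0 + (a r - a p) - (b r - b p) = (-1 : ZMod 3) by linear_combination hqr - hs,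
    twistRel_zero, twistRel_neg_one] at h2
  exact h ((lt_iff_lt_of_twistedEdge_iff hQ he hf hE hqr).2
    ((h1.1 hlt).trans (h2.1 ⟨hpr, hrp⟩)))

end TwoCopies

/-! ### Lexicographic comparisons -/

/-- Comparison rules by sign patterns that are consistent with a linear order are determined by the
sign at a single coordinate. -/
theorem exists_coordinate_forall_mem_iff {I C : Type*} [Finite I] [Nonempty C]
    (W : C → C → Set I → Prop) (huniv : ∀ c c', W c c' Set.univ)
    (hcompl : ∀ c c' S, W c c' S ↔ ¬ W c' c Sᶜ)
    (hcomp : ∀ c c' c'' S T R, W c c' S → W c' c'' T → S ∩ T ⊆ R → R ⊆ S ∪ T → W c c'' R) :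
    ∃ i, ∀ c c' S, W c c' S ↔ i ∈ S := by
  obtain ⟨c₀⟩ := ‹Nonempty C›
  -- Composing with `Set.univ` gives supersets, and composing two members gives their intersection.
  let F : Filter I :=
    { sets := {S | W c₀ c₀ S}
      univ_sets := huniv c₀ c₀
      sets_of_superset := fun {S T} hS hST =>
        hcomp _ _ _ S Set.univ T hS (huniv _ _) (by simpa using hST) (by simp)
      inter_sets := fun {S T} hS hT => hcomp _ _ _ S T _ hS hT subset_rfl
        (Set.inter_subset_left.trans Set.subset_union_left) }
  have hF : ∀ S, S ∈ F ↔ W c₀ c₀ S := fun _ => Iff.rfl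
  obtain ⟨i, hi⟩ := (Ultrafilter.ofComplNotMemIff F fun S => by
    rw [hF, hF]; exact (hcompl c₀ c₀ S).symm).eq_pure_of_finite
  have hi' : ∀ S, W c₀ c₀ S ↔ i ∈ S := fun S => by
    rw [← hF, ← Ultrafilter.mem_pure, ← hi]
    rfl
  -- Composition with `Set.univ` on either side moves from `c₀` to arbitrary colours.
  have key : ∀ c c' S, i ∈ S → W c c' S := by
    intro c c' S hS
    refine hcomp c c₀ c' S Set.univ S ?_ (huniv _ _) (by simp) (by simp)
    exact hcomp c c₀ c₀ Set.univ S S (huniv _ _) ((hi' S).2 hS) (by simp) (by simp)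
  refine ⟨i, fun c c' S => ⟨fun h => ?_, key c c' S⟩⟩
  by_contra hS
  exact (hcompl c c' S).1 h (key c' c _ hS)

/-- A finite suborder of `P` is an intersection of linear orders of which the restriction of a given
linear extension is one, at a prescribed place. -/
theorem IsLinearExtension.exists_realizer {P : Type*} [PartialOrder P] {lt : P → P → Prop}
    (hlt : IsLinearExtension lt) {A : Type*} [Finite A] {g : A → P} (hg : Function.Injective g)
    {d l : ℕ} (hd : d = Nat.card A + 2) (hl : 2 * Nat.card A ≤ l) (i : Fin d) :
    ∃ s : A → Fin d → Fin l, (∀ x y, x ≠ y → ∀ j, s x j ≠ s y j) ∧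
      (∀ x y, g x < g y ↔ ∀ j, s x j < s y j) ∧ ∀ x y, lt (g x) (g y) ↔ s x i < s y i := by
  classical
  have := hlt.strictTotal
  have := Fintype.ofFinite A
  set n := Nat.card A with hn
  let rank : A → ℕ := fun x => (Finset.univ.filter fun z => lt (g z) (g x)).card
  have hrank_lt : ∀ x, rank x < n := by
    intro x
    rw [hn, Nat.card_eq_fintype_card]
    refine Finset.card_lt_card (Finset.filter_ssubset.2 ⟨x, Finset.mem_univ _, irrefl _⟩)
  have hmono : ∀ x y, lt (g x) (g y) → rank x < rank y := by
    intro x y hxy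
    refine Finset.card_lt_card (Finset.ssubset_iff_of_subset ?_ |>.2 ⟨x, by simpa using hxy, ?_⟩)
    · intro z hz
      simp only [Finset.mem_filter, Finset.mem_univ, true_and] at hz ⊢
      exact _root_.trans hz hxy
    · simpa using irrefl_of lt (g x)
  have hrank : ∀ x y, lt (g x) (g y) ↔ rank x < rank y := by
    refine fun x y => ⟨hmono x y, fun h => ?_⟩
    rcases trichotomous_of lt (g x) (g y) with h1 | h1 | h1
    · exact h1
    · rw [hg h1] at h; exact absurd h (lt_irrefl _)
    · exact absurd (hmono _ _ h1) h.asymm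
  have hrank_inj : ∀ x y, x ≠ y → rank x ≠ rank y := by
    intro x y hxy
    rcases trichotomous_of lt (g x) (g y) with h1 | h1 | h1
    · exact (hmono _ _ h1).ne
    · exact absurd (hg h1) hxy
    · exact (hmono _ _ h1).ne'
  -- The order at `z` lifts the up-set of `z` above everything else, which puts `z` above each point
  -- not in it. Of the two plain copies of `rank`, one represents `lt`; the other keeps the
  -- dimension at least 2 when `A` is empty.
  let ρ : Option (Option A) → A → ℕ := fun o x =>
    match o with
    | some (some z) => (if g z ≤ g x then n else 0) + rank x
    | _ => rank x
  have hρ_lt : ∀ o x, ρ o x < l := by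
    intro o x
    have := hrank_lt x
    rcases o with _ | _ | z <;> simp only [ρ] <;> (try split_ifs) <;> omega
  have hρ_ne : ∀ o x y, x ≠ y → ρ o x ≠ ρ o y := by
    intro o x y hxy
    have := hrank_lt x
    have := hrank_lt y
    have := hrank_inj x y hxy
    rcases o with _ | _ | z <;> simp only [ρ] <;> (try split_ifs) <;> omega
  have hρ : ∀ x y, g x < g y ↔ ∀ o, ρ o x < ρ o y := by
    intro x y
    constructor
    · intro hxy o
      have h1 := hmono x y (hlt.extends_lt _ _ hxy)
      rcases o with _ | _ | z
      · exact h1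
      · exact h1
      · simp only [ρ]
        split_ifs with h2 h3
        · omega
        · exact absurd (h2.trans hxy.le) h3
        · omega
        · omega
    · intro h
      have h1 := h (some (some x))
      have h2 := hrank_lt y
      simp only [ρ, le_refl, if_true] at h1
      have h3 : g x ≤ g y := by
        by_contra h3
        rw [if_neg h3] at h1
        omega
      refine lt_of_le_of_ne h3 fun h4 => ?_
      rw [hg h4] at h1
      simp at h1
  have hcard : Fintype.card (Fin d) = Fintype.card (Option (Option A)) := by
    simp [hd, hn, Nat.card_eq_fintype_card]
  let ε₀ : Fin d ≃ Option (Option A) := Fintype.equivOfCardEq hcard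
  let ε : Fin d ≃ Option (Option A) := ε₀.trans (Equiv.swap (ε₀ i) none)
  have hε : ε i = none := by simp [ε]
  refine ⟨fun x j => ⟨ρ (ε j) x, hρ_lt _ _⟩, fun x y hxy j h => ?_, fun x y => ?_, fun x y => ?_⟩
  · exact hρ_ne _ _ _ hxy (Fin.mk.inj_iff.1 h)
  · rw [hρ, ← ε.forall_congr_right]
    simp only [Fin.mk_lt_mk]
  · rw [hrank, Fin.mk_lt_mk, hε]

/-! ### Canonical subgrids -/

/-- Three rows of points of a grid realise all compatible sign patterns. -/
theorem exists_rows_of_signs {d l : ℕ} (hl : 3 ≤ l) {S T R : Set (Fin d)} (h₁ : S ∩ T ⊆ R)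
    (h₂ : R ⊆ S ∪ T) : ∃ s t u : Fin d → Fin l,
      (∀ j, s j ≠ t j) ∧ (∀ j, t j ≠ u j) ∧ (∀ j, s j ≠ u j) ∧
      {j | s j < t j} = S ∧ {j | t j < u j} = T ∧ {j | s j < u j} = R := by
  have key : ∀ j, ∃ a b c : Fin l, a ≠ b ∧ b ≠ c ∧ a ≠ c ∧ (a < b ↔ j ∈ S) ∧ (b < c ↔ j ∈ T) ∧
      (a < c ↔ j ∈ R) := by
    intro j
    have h₁' := @h₁ j
    have h₂' := @h₂ j
    simp only [Set.mem_inter_iff, Set.mem_union] at h₁' h₂'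
    let x : Fin l := ⟨0, by omega⟩
    let y : Fin l := ⟨1, by omega⟩
    let z : Fin l := ⟨2, by omega⟩
    -- Six cases are the six orders of three values; the other two would be cyclic.
    by_cases hS : j ∈ S <;> by_cases hT : j ∈ T <;> by_cases hR : j ∈ R
    · exact ⟨x, y, z, by simp [x, y, z, hS, hT, hR]⟩
    · exact absurd (h₁' ⟨hS, hT⟩) hR
    · exact ⟨x, z, y, by simp [x, y, z, hS, hT, hR]⟩
    · exact ⟨y, z, x, by simp [x, y, z, hS, hT, hR]⟩
    · exact ⟨y, x, z, by simp [x, y, z, hS, hT, hR]⟩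
    · exact ⟨z, x, y, by simp [x, y, z, hS, hT, hR]⟩
    · exact absurd (h₂' hR) (by tauto)
    · exact ⟨z, y, x, by simp [x, y, z, hS, hT, hR]⟩
  choose s t u h1 h2 h3 h4 h5 h6 using key
  exact ⟨s, t, u, h1, h2, h3, Set.ext h4, Set.ext h5, Set.ext h6⟩

/-- There is a finite subset `e '' G` of `P` such that every copy `f '' G` of its twisted digraph
contains a coloured grid with the strict product order, in which points that differ in all
coordinates are compared by the linear extension according to a single coordinate. -/
theorem exists_canonical_grid {P : Type*} [PartialOrder P] [Countable P]
    (hP : IsGenericPartialOrder P) {Q : ZMod 3 → Set P} (hQ : IsDensePartition Q)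
    {lt : P → P → Prop} (hlt : IsLinearExtension lt) {d l : ℕ} (hd : 2 ≤ d) (hl : 4 ≤ l) :
    ∃ (G : Type) (_ : Finite G) (e : G → P), Function.Injective e ∧
      ∀ f : G → P, Function.Injective f →
        (∀ p q, twistedEdge Q (e p) (e q) ↔ twistedEdge Q (f p) (f q)) →
        ∃ (p : (Fin d → Fin l) → ZMod 3 → G) (i : Fin d), (∀ s c, f (p s c) ∈ Q c) ∧
          (∀ s t c c', f (p s c) < f (p t c') ↔ ∀ j, s j < t j) ∧
          ∀ s t c c', (∀ j, s j ≠ t j) → (lt (f (p s c)) (f (p t c')) ↔ s i < t i) := by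
  have := hlt.strictTotal
  obtain ⟨M, hM⟩ := exists_subgrid_color_eq (l + 1) d
    (K := (ZMod 3 → ZMod 3) × (ZMod 3 → ZMod 3 → Prop))
  replace hM := hM M le_rfl
  let i₀ : Fin d := ⟨0, by omega⟩
  let i₁ : Fin d := ⟨1, by omega⟩
  obtain ⟨e, he_inj, he, he_lt⟩ := hP.exists_colored_embedding hQ
    (G := (Fin d → Fin M) × ZMod 3) (fun x y => ∀ j, x.1 j < y.1 j)
    (fun x h => lt_irrefl _ (h i₀)) (fun x y z h h' j => (h j).trans (h' j)) Prod.snd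
  refine ⟨_, inferInstance, e, he_inj, fun f hf_inj hE => ?_⟩
  choose b hb using fun p => (hQ.existsUnique (f p)).exists
  obtain ⟨q, hq, κ, hκ⟩ := hM fun x y =>
    (fun c => b (x, c), fun c c' => lt (f (x, c)) (f (y, c')))
  let p : (Fin d → Fin l) → ZMod 3 → (Fin d → Fin M) × ZMod 3 := fun s c =>
    (fun j => q j (s j).castSucc, c)
  let h : ZMod 3 → ZMod 3 := (κ Set.univ).1
  have hbp : ∀ s c, b (p s c) = h c := by
    intro s c
    -- The spare last row lies above every point of the subgrid, so each point is the first of a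
    -- pair with full sign pattern.
    have h1 := hκ (fun j => (s j).castSucc) (fun _ => Fin.last l)
      (fun j => (Fin.castSucc_lt_last _).ne)
    rw [show {j | (s j).castSucc < Fin.last l} = Set.univ from
      Set.eq_univ_of_forall fun j => Fin.castSucc_lt_last _] at h1
    exact congrFun (congrArg Prod.fst h1) c
  have hep : ∀ s t c c', e (p s c) < e (p t c') ↔ ∀ j, s j < t j := by
    intro s t c c'
    rw [he_lt]
    exact forall_congr' fun j => (hq j).lt_iff_lt.trans Fin.castSucc_lt_castSucc_iff
  have hshift : ∀ c c', h c' - c' ≠ 1 + (h c - c) := by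
    intro c c'
    -- `u` drops below `s` and `t` in one coordinate and exceeds them in the others; this is where
    -- `2 ≤ d` and `4 ≤ l` are needed.
    let s : Fin d → Fin l := fun _ => ⟨1, by omega⟩
    let t : Fin d → Fin l := fun _ => ⟨2, by omega⟩
    let u : Fin d → Fin l := fun j => if j = i₀ then ⟨0, by omega⟩ else ⟨3, by omega⟩
    have h01 : i₁ ≠ i₀ := by simp [i₀, i₁]
    have := shift_ne_of_twistedEdge_iff (a := Prod.snd) hQ.existsUnique he hb hE (p := p s c)
      (q := p t c') (r := p u c') (by simp only [hbp, p]) ((hep _ _ _ _).2 fun j => by simp [s, t])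
      (fun hh => by simpa [s, u] using (hep _ _ _ _).1 hh i₀)
      (fun hh => by simpa [s, u, h01] using (hep _ _ _ _).1 hh i₁)
      (fun hh => by simpa [t, u] using (hep _ _ _ _).1 hh i₀)
    simpa only [hbp, p] using this
  -- Of two distinct residues modulo 3, one is the other plus one.
  have hconst : ∀ c, h c = c + h 0 := by
    intro c
    have h1 := hshift c 0
    have h2 := hshift 0 c
    rw [sub_zero] at h1 h2
    generalize h 0 = y at *
    generalize h c = x at *
    clear * - h1 h2
    revert x y c
    decide
  have hfp : ∀ s t c c', f (p s c) < f (p t c') ↔ ∀ j, s j < t j := by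
    intro s t c c'
    rw [← hep s t c c']
    refine (lt_iff_lt_of_twistedEdge_iff (a := Prod.snd) hQ.existsUnique he hb hE ?_).symm
    rw [hbp, hbp, hconst c, hconst c']
    simp [p]
  have hW : ∀ s t c c', (∀ j, s j ≠ t j) →
      (lt (f (p s c)) (f (p t c')) ↔ (κ {j | s j < t j}).2 c c') := by
    intro s t c c' hst
    have h1 := hκ (fun j => (s j).castSucc) (fun j => (t j).castSucc)
      (fun j h => hst j (Fin.castSucc_injective _ h))
    simp only [Fin.castSucc_lt_castSucc_iff] at h1
    exact iff_of_eq (congrFun (congrFun (congrArg Prod.snd h1) c) c')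
  -- The three conditions come from `lt` extending the order, from its totality and asymmetry, and
  -- from its transitivity.
  obtain ⟨i, hi⟩ := exists_coordinate_forall_mem_iff (fun c c' S => (κ S).2 c c')
    (by
      intro c c'
      obtain ⟨s, t, -, hst, -, -, h1, -⟩ := exists_rows_of_signs (d := d) (l := l) (by omega)
        (S := Set.univ) (T := Set.univ) (R := Set.univ) (by simp) (by simp)
      rw [← h1, ← hW s t c c' hst]
      exact hlt.extends_lt _ _ ((hfp _ _ _ _).2 fun j => (Set.ext_iff.1 h1 j).2 trivial))
    (by
      intro c c' S
      obtain ⟨s, t, -, hst, -, -, h1, -⟩ := exists_rows_of_signs (d := d) (l := l) (by omega)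
        (S := S) (T := S) (R := S) (by simp) (by simp)
      have h2 : {j | t j < s j} = Sᶜ := by
        rw [← h1]
        ext j
        simp only [Set.mem_ofPred_eq, Set.mem_compl_iff, not_lt]
        exact ⟨le_of_lt, fun h => lt_of_le_of_ne h (hst j).symm⟩
      rw [← h2, ← h1, ← hW s t c c' hst, ← hW t s c' c fun j => (hst j).symm]
      have hne : f (p s c) ≠ f (p t c') := by
        intro h3
        have h4 := congrFun (congrArg Prod.fst (hf_inj h3)) i₀
        exact hst i₀ (Fin.castSucc_injective _ ((hq i₀).injective h4))
      constructor
      · exact fun h3 h4 => asymm h3 h4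
      · intro h3
        rcases trichotomous_of lt (f (p s c)) (f (p t c')) with h4 | h4 | h4
        exacts [h4, absurd h4 hne, absurd h4 h3])
    (by
      intro c c' c'' S T R hS hT h1 h2
      obtain ⟨s, t, u, hst, htu, hsu, rfl, rfl, rfl⟩ :=
        exists_rows_of_signs (d := d) (l := l) (by omega) h1 h2
      rw [← hW _ _ _ _ hst] at hS
      rw [← hW _ _ _ _ htu] at hT
      rw [← hW _ _ _ _ hsu]
      exact _root_.trans hS hT)
  -- Subtracting `h 0` undoes the rotation of the colours.
  refine ⟨fun s c => p s (c - h 0), i, fun s c => ?_, fun s t c c' => hfp _ _ _ _,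
    fun s t c c' hst => (hW _ _ _ _ hst).trans (hi _ _ _)⟩
  have h1 := hb (p s (c - h 0))
  rwa [hbp, hconst, sub_add_cancel] at h1

/-! ### The expansion property -/

/-- There is a finite subset `e '' G` of `P` such that every copy of its twisted digraph contains
copies of all substructures of size `n` of the expansion. -/
theorem exists_forall_exists_copy {P : Type*} [PartialOrder P] [Countable P]
    (hP : IsGenericPartialOrder P) {Q : ZMod 3 → Set P} (hQ : IsDensePartition Q)
    {lt : P → P → Prop} (hlt : IsLinearExtension lt) (n : ℕ) :
    ∃ (G : Type) (_ : Finite G) (e : G → P), Function.Injective e ∧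
      ∀ f : G → P, Function.Injective f →
        (∀ p q, twistedEdge Q (e p) (e q) ↔ twistedEdge Q (f p) (f q)) →
        ∀ {A : Type*} [Finite A] (g : A → P), Nat.card A = n → Function.Injective g →
          ∃ h : A → G, (∀ x i, f (h x) ∈ Q i ↔ g x ∈ Q i) ∧
            (∀ x y, f (h x) < f (h y) ↔ g x < g y) ∧
            ∀ x y, lt (f (h x)) (f (h y)) ↔ lt (g x) (g y) := by
  -- The realizer needs dimension `n + 2` and side `2 * n`; the extra 4 is for the grid.
  obtain ⟨G, hG, e, he, H⟩ := exists_canonical_grid hP hQ hlt (d := n + 2) (l := 2 * n + 4)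
    (by omega) (by omega)
  refine ⟨G, hG, e, he, fun f hf hE A _ g hA hg => ?_⟩
  have := hlt.strictTotal
  obtain ⟨p, i, hp, hp_lt, hp_ext⟩ := H f hf hE
  obtain ⟨s, hs, hs_lt, hs_ext⟩ := hlt.exists_realizer hg (d := n + 2) (l := 2 * n + 4)
    (by omega) (by omega) i
  choose c hc using fun x => (hQ.existsUnique (g x)).exists
  refine ⟨fun x => p (s x) (c x), fun x j => ?_, fun x y => ?_, fun x y => ?_⟩
  · constructor
    · intro h
      rw [(hQ.existsUnique _).unique h (hp _ _)]
      exact hc x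
    · intro h
      rw [(hQ.existsUnique _).unique h (hc x)]
      exact hp _ _
  · rw [hp_lt, hs_lt]
  · rcases eq_or_ne x y with rfl | hxy
    · exact iff_of_false (irrefl _) (irrefl _)
    · rw [hp_ext _ _ _ _ (hs x y hxy), hs_ext]

theorem twistedEdge_congr {P : Type*} [PartialOrder P] {Q : ZMod 3 → Set P} {x y x' y' : P}
    (hx : ∀ i, x ∈ Q i ↔ x' ∈ Q i) (hy : ∀ i, y ∈ Q i ↔ y' ∈ Q i) (h : x < y ↔ x' < y')
    (h' : y < x ↔ y' < x') : twistedEdge Q x y ↔ twistedEdge Q x' y' := by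
  simp only [twistedEdge, TwistRel, hx, hy, h, h']

/-- The digraph on (a lift of) `G` of which `e` is an embedding in `𝒫(3)`. -/
def pulledBackDigraph {P : Type*} [PartialOrder P] (Q : ZMod 3 → Set P) {G : Type} (e : G → P) :
    Bundled digraphLang.Structure where
  α := ULift G
  str :=
    { funMap := fun f => nomatch f
      RelMap := fun r => match r with
        | DigraphRel.edge => fun v => twistedEdge Q (e (v 0).down) (e (v 1).down) }

theorem pulledBackDigraph_mem_age {P : Type*} [PartialOrder P] (Q : ZMod 3 → Set P) {G : Type}
    [Finite G] {e : G → P} (he : Function.Injective e) :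
    pulledBackDigraph Q e ∈ digraphLang.age (P3 Q) := by
  have : Finite (pulledBackDigraph Q e) := inferInstanceAs (Finite (ULift G))
  refine ⟨Language.Structure.FG.of_finite, ⟨?_⟩⟩
  refine
    { toFun := fun b : ULift G => e b.down
      inj' := fun b b' h => ULift.down_injective (he h)
      map_fun' := fun f => nomatch f
      map_rel' := fun r v => ?_ }
  cases r
  exact Iff.rfl

theorem mainTheorem4 {P : Type*} [PartialOrder P] [Countable P] (hP : IsGenericPartialOrder P)
    (Q : ZMod 3 → Set P) (hQ : IsDensePartition Q)
    (lt : P → P → Prop) (hlt : IsLinearExtension lt) (hF : IsFraisseStructure (P3star Q lt)) :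
    HasExpansionProperty digraphToExp (expLang.age (P3star Q lt)) (digraphLang.age (P3 Q)) := by
  intro A hA
  have hAfin : Finite A := hA.1.finite
  have := hlt.strictTotal
  have hirr : ∀ x : P, ¬ lt x x := irrefl_of lt
  obtain ⟨G, hG, e, he, H⟩ := exists_forall_exists_copy hP hQ hlt (Nat.card A)
  refine ⟨pulledBackDigraph Q e, pulledBackDigraph_mem_age Q he, ?_⟩
  rintro sA sB ⟨-, ⟨g⟩⟩ ⟨-, ⟨f⟩⟩ - hB
  have hE : ∀ p q : G, twistedEdge Q (e p) (e q) ↔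
      twistedEdge Q (f (⟨p⟩ : ULift G)) (f (⟨q⟩ : ULift G)) := by
    intro p q
    have h1 := f.map_rel ExpRel.edge ![(⟨p⟩ : ULift G), (⟨q⟩ : ULift G)]
    have h2 : (digraphToExp.reduct (pulledBackDigraph Q e)).RelMap DigraphRel.edge
        ![(⟨p⟩ : ULift G), (⟨q⟩ : ULift G)] ↔ twistedEdge Q (e p) (e q) := by
      rw [hB]
      exact Iff.rfl
    exact h2.symm.trans h1.symm
  obtain ⟨h, hpart, hlt', hext⟩ := H (fun p => f (⟨p⟩ : ULift G))
    (fun p q hpq => congrArg ULift.down (f.injective hpq)) hE (A := A) (fun x => g x) rfl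
    g.injective
  refine ⟨
    { toFun := fun x => (⟨h x⟩ : ULift G)
      inj' := fun x y hxy => ?_
      map_fun' := fun f => nomatch f
      map_rel' := fun r v => ?_ }⟩
  -- Points with equal images are not comparable by `lt`, hence equal by totality.
  · have hxy : h x = h y := congrArg ULift.down hxy
    have h1 := hext x y
    have h2 := hext y x
    rw [hxy] at h1 h2
    rcases trichotomous_of lt (g x) (g y) with h3 | h3 | h3
    · exact absurd (h1.2 h3) (hirr _)
    · exact g.injective h3
    · exact absurd (h2.2 h3) (hirr _)
  · refine (f.map_rel r _).symm.trans (Iff.trans ?_ (g.map_rel r v))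
    cases r with
    | edge => exact twistedEdge_congr (hpart _) (hpart _) (hlt' _ _) (hlt' _ _)
    | part i => exact hpart _ i
    | lt => exact hext _ _
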